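/- The burning game on a finite simple graph $G$ is played by Burner and Staller. Initially no vertex is burned, and burned vertices stay burned. In each time step $t\ge 1$, first all neighbors of burned vertices become burned; then, if an unburned vertex remains, one of the players (they alternate from one time step to the next) burns one unburned vertex. The game ends in the first time step in which all vertices of $G$ are burned. Burner wants to minimize, and Staller to maximize, the number of time steps. Under optimal play this number is $b_{\rm g}(G)$ if Burner makes the first move and $b_{\rm g}'(G)$ if Staller makes the first move. Let $n\ge 1$ and let $Q_n$ be the $n$-dimensional hypercube, i.e. the $n$-fold Cartesian product $K_2\,\Box\,\cdots\,\Box\,K_2$ (vertex set $\{0,1\}^n$, two vertices being adjacent if and only if they differ in exactly one coordinate). Then \[ b_{\rm g}(Q_n)=\begin{cases}2, & n\in\{1,2\},\\[2pt] \left\lceil\frac{n+1}{2}\right\rceil+1, & \text{otherwise,}\end{cases} \qquad\text{and}\qquad b_{\rm g}'(Q_n)=\left\lceil\frac{n}{2}\right\rceil+1 . \] -/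

import Mathlib

/-- The state after the spreading phase: every burned vertex stays burned and all neighbors of
burned vertices become burned. -/
def burnSpread {V : Type*} (G : SimpleGraph V) (B : Set V) : Set V :=
  {v | v ∈ B ∨ ∃ u ∈ B, G.Adj u v}

/-- The two players of the burning game. -/
inductive BurnPlayer where
  | burner : BurnPlayer
  | staller : BurnPlayer

/-- `BurnerForces G p B k`: in the burning game on `G`, when `B` is the set of vertices burned so
far and player `p` makes the selection of the next time step, Burner can force all vertices to be
burned within at most `k` further time steps, whatever Staller does.

If all vertices are burned the game is over. Otherwise a time step takes place: the fire spreads to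
`burnSpread G B`; if that is everything, the game ends in this time step; else the player whose
turn it is burns one unburned vertex `v`, and the other player is next to select. Burner needs some
good `v` on his turns, and has to cope with every `v` on the turns of Staller. -/
def BurnerForces {V : Type*} (G : SimpleGraph V) : BurnPlayer → Set V → ℕ → Prop
  | _, B, 0 => B = Set.univ
  | .burner, B, k + 1 =>
      B = Set.univ ∨ burnSpread G B = Set.univ ∨
        ∃ v, v ∉ burnSpread G B ∧ BurnerForces G .staller (insert v (burnSpread G B)) k
  | .staller, B, k + 1 =>
      B = Set.univ ∨ burnSpread G B = Set.univ ∨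
        ∀ v, v ∉ burnSpread G B → BurnerForces G .burner (insert v (burnSpread G B)) k

/-- On a finite graph the game always ends: the number of unburned vertices is a bound on the
number of remaining time steps. So the minimum in the definitions below is over a nonempty set. -/
theorem burnerForces_of_ncard_compl_le {V : Type*} [Finite V] (G : SimpleGraph V) (k : ℕ) :
    ∀ (p : BurnPlayer) (B : Set V), Bᶜ.ncard ≤ k → BurnerForces G p B k := by
  induction k with
  | zero =>
    intro p B h
    have h0 : Bᶜ = ∅ := (Set.ncard_eq_zero (Set.toFinite _)).1 (Nat.le_zero.1 h)
    have hB : B = Set.univ := by simpa using h0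
    cases p <;> simpa [BurnerForces] using hB
  | succ k ih =>
    intro p B h
    have key : ∀ v, v ∉ burnSpread G B → (insert v (burnSpread G B))ᶜ.ncard ≤ k := by
      intro v hv
      have hlt : (insert v (burnSpread G B))ᶜ.ncard < Bᶜ.ncard := by
        refine Set.ncard_lt_ncard ?_ (Set.toFinite _)
        refine compl_lt_compl_iff_lt.2 ((Set.ssubset_iff_of_subset ?_).2 ⟨v, ?_, ?_⟩)
        · exact fun w hw => Or.inr (Or.inl hw)
        · exact Or.inl rfl
        · exact fun hw => hv (Or.inl hw)
      omega
    by_cases hS : burnSpread G B = Set.univ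
    · cases p <;> exact Or.inr (Or.inl hS)
    · cases p with
      | burner =>
        obtain ⟨v, hv⟩ := (Set.ne_univ_iff_exists_notMem _).1 hS
        exact Or.inr (Or.inr ⟨v, hv, ih _ _ (key v hv)⟩)
      | staller => exact Or.inr (Or.inr fun v hv => ih _ _ (key v hv))

/-- The number of time steps of the burning game on `G` under optimal play when player `p` makes the
first move and no vertex is burned at the start: the least number of time steps within which Burner
can force the whole graph to burn. -/
noncomputable def burningGameLength {V : Type*} [Finite V] (G : SimpleGraph V) (p : BurnPlayer) :
    ℕ :=
  sInf {k : ℕ | BurnerForces G p ∅ k}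

/-- The game burning number `b_g(G)` (Burner makes the first move). -/
noncomputable def gameBurningNumber {V : Type*} [Finite V] (G : SimpleGraph V) : ℕ :=
  burningGameLength G .burner

/-- The Staller-start game burning number `b_g'(G)`. -/
noncomputable def stallerStartGameBurningNumber {V : Type*} [Finite V] (G : SimpleGraph V) : ℕ :=
  burningGameLength G .staller

/-- The `n`-dimensional hypercube `Q_n`, the `n`-fold Cartesian product of `K_2`: vertices are the
0-1 vectors of length `n`, adjacent when they differ in exactly one coordinate. -/
def hypercubeGraph (n : ℕ) : SimpleGraph (Fin n → Bool) where
  Adj x y := hammingDist x y = 1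
  symm := ⟨fun x y h => by rw [hammingDist_comm]; exact h⟩
  loopless := ⟨fun x h => by simp at h⟩

/-! Upper bounds: as soon as he can, Burner burns the antipode of the first selected vertex. Two
antipodal balls then grow by one per time step, and they cover the cube once their radii sum to at
least `n - 1`. Lower bounds: if Burner wins within `k` steps, then in some play the balls of radius
`k - 1 - m` around the selections `a m` (counted from `0`) cover the cube. For signs `±1` the inner
product of `z` and `a m` is `n - 2 * hammingDist z (a m)`, so an uncovered `z` comes from a sign
vector whose product with `a m` is at most `2 * m`. Such a vector is found by floating rounding from
the origin (`exists_sign_rounding`): with `f + 1` free coordinates, a linear-algebra move fixes one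
more while leaving the first `f` products unchanged. This settles everything except Burner's start
with even `n ≥ 4`, where one more step is needed. There Staller replies at distance two from the
first vertex, and rounding from a tilted point gains the step (`exists_hammingDist_add_ge_of_ne`).
-/

/-! ### Rounding points of the real cube to sign vectors -/

open Finset in
/-- A point of the cube can be moved along `d` to a point of the cube that has a new coordinate
`±1`, provided `d` vanishes on the coordinates that are already `±1`. -/
theorem exists_move_to_face {ι : Type*} [Fintype ι] (x d : ι → ℝ) (hx : ∀ i, |x i| ≤ 1)
    (hd : d ≠ 0) (hdx : ∀ i, |x i| = 1 → d i = 0) :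
    ∃ t : ℝ, 0 ≤ t ∧ (∀ i, |x i + t * d i| ≤ 1) ∧ ∃ i, |x i| ≠ 1 ∧ |x i + t * d i| = 1 := by
  classical
  obtain ⟨i₁, hi₁⟩ := Function.ne_iff.1 hd
  -- The quotient is the time at which coordinate `i` reaches the sign of `d i`; the earliest such
  -- time is taken.
  obtain ⟨i₀, hi₀, hmin⟩ := (univ.filter fun i => d i ≠ 0).exists_min_image
    (fun i => (|d i| - d i * x i) / d i ^ 2) ⟨i₁, by simpa using hi₁⟩
  simp only [mem_filter, mem_univ, true_and] at hi₀ hmin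
  have hnonneg : ∀ i, 0 ≤ |d i| - d i * x i := fun i => by
    have h1 : |d i * x i| ≤ |d i| := by
      rw [abs_mul]; exact mul_le_of_le_one_right (abs_nonneg _) (hx i)
    linarith [le_abs_self (d i * x i)]
  set t := (|d i₀| - d i₀ * x i₀) / d i₀ ^ 2 with ht
  have ht0 : 0 ≤ t := div_nonneg (hnonneg i₀) (sq_nonneg _)
  refine ⟨t, ht0, fun i => ?_, i₀, fun h => hi₀ (hdx i₀ h), ?_⟩
  · by_cases hdi : d i = 0
    · simpa [hdi] using hx i
    · have h := hmin i hdi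
      rw [le_div_iff₀ (by positivity)] at h
      have hxi := abs_le.1 (hx i)
      rcases lt_or_gt_of_ne hdi with hneg | hpos
      · rw [abs_of_neg hneg] at h
        have h2 : -(t * d i) ≤ 1 + x i := by
          by_contra! hc
          nlinarith
        have h3 : t * d i ≤ 0 := mul_nonpos_of_nonneg_of_nonpos ht0 hneg.le
        exact abs_le.2 ⟨by linarith, by linarith⟩
      · rw [abs_of_pos hpos] at h
        have h2 : t * d i ≤ 1 - x i := by
          by_contra! hc
          nlinarith
        have h3 : 0 ≤ t * d i := mul_nonneg ht0 hpos.le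
        exact abs_le.2 ⟨by linarith, by linarith⟩
  · have h : x i₀ + t * d i₀ = |d i₀| / d i₀ := by
      rw [ht]; field_simp; ring
    rw [h, abs_div, abs_abs, div_self (abs_ne_zero.2 hi₀)]

open Finset in
/-- A nonzero vector that vanishes where `|x i| = 1`, is orthogonal to fewer vectors than there are
other coordinates, and has nonpositive product with one more vector. -/
theorem exists_direction {ι : Type*} [Fintype ι] (x : ι → ℝ) (b : ℕ → ι → ℝ) (f : ℕ)
    (hf : #{i | |x i| ≠ 1} = f + 1) :
    ∃ d : ι → ℝ, d ≠ 0 ∧ (∀ i, |x i| = 1 → d i = 0) ∧ (∀ m < f, ∑ i, d i * b m i = 0) ∧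
      ∑ i, d i * b f i ≤ 0 := by
  classical
  let L : (ι → ℝ) →ₗ[ℝ] ({i // |x i| = 1} → ℝ) × (Fin f → ℝ) :=
    { toFun := fun d => (fun i => d i, fun m => ∑ i, d i * b m i)
      map_add' := fun d e => by
        ext <;> simp [add_mul, sum_add_distrib]
      map_smul' := fun c d => by
        ext <;> simp [mul_sum, mul_assoc] }
  have hlt : Module.finrank ℝ (({i // |x i| = 1} → ℝ) × (Fin f → ℝ)) <
      Module.finrank ℝ (ι → ℝ) := by
    rw [Module.finrank_prod, Module.finrank_fintype_fun_eq_card,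
      Module.finrank_fintype_fun_eq_card, Module.finrank_fintype_fun_eq_card, Fintype.card_fin,
      Fintype.card_subtype]
    have h := card_filter_add_card_filter_not (s := (univ : Finset ι)) (fun i => |x i| = 1)
    rw [card_univ] at h
    have h' : #{i | ¬ |x i| = 1} = f + 1 := hf
    omega
  obtain ⟨d, hd, hd0⟩ := (Submodule.ne_bot_iff _).1 (LinearMap.ker_ne_bot_of_finrank_lt (f := L) hlt)
  have h1 : ∀ i, |x i| = 1 → d i = 0 := fun i hi =>
    congrFun (congrArg Prod.fst (LinearMap.mem_ker.1 hd)) ⟨i, hi⟩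
  have h2 : ∀ m < f, ∑ i, d i * b m i = 0 := fun m hm =>
    congrFun (congrArg Prod.snd (LinearMap.mem_ker.1 hd)) ⟨m, hm⟩
  rcases le_total (∑ i, d i * b f i) 0 with h | h
  · exact ⟨d, hd0, h1, h2, h⟩
  · refine ⟨-d, neg_ne_zero.2 hd0, fun i hi => by simp [h1 i hi], fun m hm => ?_, ?_⟩
    · simpa using h2 m hm
    · simpa using h

open Finset in
/-- Rounding the free coordinates of `x` changes the product with a vector of sup norm at most `1`
by less than twice their number. -/
theorem abs_sum_sub_lt_of_rounding {ι : Type*} [Fintype ι] (x z b : ι → ℝ) (hx : ∀ i, |x i| ≤ 1)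
    (hz : ∀ i, |z i| = 1) (hzx : ∀ i, |x i| = 1 → z i = x i) (hb : ∀ i, |b i| ≤ 1)
    (hf : 0 < #{i | |x i| ≠ 1}) :
    |∑ i, z i * b i - ∑ i, x i * b i| < 2 * (#{i | |x i| ≠ 1} : ℝ) := by
  classical
  have h1 : ∑ i, z i * b i - ∑ i, x i * b i = ∑ i with |x i| ≠ 1, (z i - x i) * b i := by
    rw [← sum_sub_distrib, sum_filter]
    refine sum_congr rfl fun i _ => ?_
    split_ifs with h
    · ring
    · rw [hzx i (not_not.1 h)]; ring
  rw [h1]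
  refine (abs_sum_le_sum_abs _ _).trans_lt ?_
  have h2 : ∀ i ∈ ({i | |x i| ≠ 1} : Finset ι), |(z i - x i) * b i| < 2 := fun i hi => by
    have hi' : |x i| < 1 := lt_of_le_of_ne (hx i) (by simpa using hi)
    have h3 : |z i - x i| < 2 := by
      have := abs_sub (z i) (x i)
      linarith [hz i]
    rw [abs_mul]
    exact (mul_le_of_le_one_right (abs_nonneg _) (hb i)).trans_lt h3
  refine (sum_lt_sum_of_nonempty (card_pos.1 hf) h2).trans_eq ?_
  rw [sum_const, nsmul_eq_mul, mul_comm]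

open Finset in
/-- A point of the cube can be rounded to a sign vector so that the product with the `m`-th of a
sequence of vectors increases by less than `2 * m`. -/
theorem exists_sign_rounding {ι : Type*} [Fintype ι] (b : ℕ → ι → ℝ) (hb : ∀ m i, |b m i| ≤ 1)
    (x : ι → ℝ) (hx : ∀ i, |x i| ≤ 1) :
    ∃ z : ι → ℝ, (∀ i, |z i| = 1) ∧ (∀ i, |x i| = 1 → z i = x i) ∧
      ∑ i, z i * b 0 i ≤ ∑ i, x i * b 0 i ∧ ∑ i, x i * b 0 i - 2 < ∑ i, z i * b 0 i ∧
      ∀ m, 1 ≤ m → ∑ i, z i * b m i < ∑ i, x i * b m i + 2 * m := by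
  classical
  induction hF : #{i | |x i| ≠ 1} using Nat.strong_induction_on generalizing x with
  | _ F ih =>
    rcases F with _ | f
    · have h1 : ∀ i, |x i| = 1 := by
        intro i
        by_contra h
        have : i ∈ ({i | |x i| ≠ 1} : Finset ι) := by simpa using h
        rw [card_eq_zero.1 hF] at this
        simp at this
      refine ⟨x, h1, fun _ _ => rfl, le_rfl, by linarith, fun m hm => ?_⟩
      have : (1 : ℝ) ≤ m := by exact_mod_cast hm
      linarith
    · obtain ⟨d, hd0, hdx, hdb, hdf⟩ := exists_direction x b f hF
      obtain ⟨t, ht0, htx, i₀, hi₀, hi₀'⟩ := exists_move_to_face x d hx hd0 hdx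
      have hkeep : ∀ i, |x i| = 1 → x i + t * d i = x i := fun i hi => by rw [hdx i hi]; ring
      have hlt : #{i | |x i + t * d i| ≠ 1} < f + 1 := by
        rw [← hF]
        refine card_lt_card ((ssubset_iff_of_subset ?_).2 ⟨i₀, by simpa using hi₀, by
          simpa using hi₀'⟩)
        intro i hi
        simp only [mem_filter, mem_univ, true_and] at hi ⊢
        intro h
        rw [hkeep i h] at hi
        exact hi h
      obtain ⟨z, hz, hzx, hle, hge, hm⟩ := ih _ hlt (fun i => x i + t * d i) htx rfl
      have hsum : ∀ m, ∑ i, (x i + t * d i) * b m i =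
          ∑ i, x i * b m i + t * ∑ i, d i * b m i := fun m => by
        rw [mul_sum, ← sum_add_distrib]
        exact sum_congr rfl fun i _ => by ring
      have hzx' : ∀ i, |x i| = 1 → z i = x i := fun i hi => by
        rw [hzx i (by rw [hkeep i hi]; exact hi), hkeep i hi]
      -- The move controls only `m ≤ f`. For `m ≥ f + 1` this crude bound on all remaining change
      -- suffices, as does it for `b 0` when one coordinate is free.
      have hgen : ∀ m, |∑ i, z i * b m i - ∑ i, x i * b m i| < 2 * ((f + 1 : ℕ) : ℝ) := fun m => by
        rw [← hF]
        exact abs_sum_sub_lt_of_rounding x z (b m) hx hz hzx' (hb m) (by omega)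
      have hmono : ∀ m ≤ f, ∑ i, (x i + t * d i) * b m i ≤ ∑ i, x i * b m i := fun m hmf => by
        rw [hsum]
        rcases hmf.lt_or_eq with h | rfl
        · rw [hdb m h]; linarith
        · linarith [mul_nonpos_of_nonneg_of_nonpos ht0 hdf]
      refine ⟨z, hz, hzx', hle.trans (hmono 0 (Nat.zero_le _)), ?_, fun m hm1 => ?_⟩
      · rcases Nat.eq_zero_or_pos f with rfl | hf
        · have := (abs_lt.1 (hgen 0)).1
          norm_num at this
          linarith
        · rwa [hsum, hdb 0 hf, mul_zero, add_zero] at hge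
      · rcases le_or_gt m f with h | h
        · linarith [hm m hm1, hmono m h]
        · have h1 := (abs_lt.1 (hgen m)).2
          have h2 : ((f + 1 : ℕ) : ℝ) ≤ m := by exact_mod_cast h
          linarith

/-! ### Vertices far from a given sequence -/

/-- The sign `±1` of a Boolean. -/
def boolSign (s : Bool) : ℝ := if s then 1 else -1

theorem abs_boolSign (s : Bool) : |boolSign s| = 1 := by cases s <;> simp [boolSign]

theorem boolSign_mul_self (s : Bool) : boolSign s * boolSign s = 1 := by
  cases s <;> simp [boolSign]

theorem exists_boolSign_eq {ι : Type*} (z : ι → ℝ) (hz : ∀ i, |z i| = 1) :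
    ∃ w : ι → Bool, ∀ i, z i = boolSign (w i) := by
  have h : ∀ i, ∃ s, z i = boolSign s := fun i => by
    rcases (abs_eq zero_le_one).1 (hz i) with h | h
    · exact ⟨true, by simp [boolSign, h]⟩
    · exact ⟨false, by simp [boolSign, h]⟩
  choose w hw using h
  exact ⟨w, hw⟩

theorem sum_boolSign_mul {ι : Type*} [Fintype ι] (x y : ι → Bool) :
    ∑ i, boolSign (x i) * boolSign (y i) = Fintype.card ι - 2 * (hammingDist x y : ℝ) := by
  have h : ∀ i, boolSign (x i) * boolSign (y i) = 1 - 2 * (if x i ≠ y i then 1 else 0) := fun i => by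
    cases x i <;> cases y i <;> norm_num [boolSign]
  simp_rw [h]
  rw [Finset.sum_sub_distrib, ← Finset.mul_sum, Finset.sum_boole]
  simp [hammingDist]

/-- For every sequence of vertices of the cube some vertex is far from all of them. -/
theorem exists_hammingDist_add_ge {n : ℕ} (a : ℕ → Fin n → Bool) :
    ∃ z, ∀ m, n ≤ 2 * (hammingDist z (a m) + m) := by
  obtain ⟨z, hz, -, h0, -, hm⟩ := exists_sign_rounding (fun m i => boolSign (a m i))
    (fun m i => (abs_boolSign _).le) (0 : Fin n → ℝ) (by simp)
  obtain ⟨w, hw⟩ := exists_boolSign_eq z hz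
  refine ⟨w, fun m => ?_⟩
  simp only [hw, sum_boolSign_mul, Pi.zero_apply, zero_mul, Finset.sum_const_zero,
    Fintype.card_fin] at h0 hm
  rcases Nat.eq_zero_or_pos m with rfl | h
  · have : (n : ℝ) ≤ 2 * hammingDist w (a 0) := by linarith
    exact_mod_cast this
  · have : (n : ℝ) < 2 * (hammingDist w (a m) + m) := by linarith [hm m h]
    exact_mod_cast this.le

theorem hammingDist_add_two_le {n : ℕ} {x y : Fin n → Bool} {j : Fin n} (hj : x j = y j)
    (hne : y ≠ Function.update (fun l => !x l) j (x j)) : hammingDist x y + 2 ≤ n := by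
  obtain ⟨l, hl⟩ := Function.ne_iff.1 hne
  have hlj : l ≠ j := by
    rintro rfl
    simp [hj] at hl
  have hl' : x l = y l := by
    rw [Function.update_of_ne hlj] at hl
    revert hl
    cases x l <;> cases y l <;> simp
  have hsub : (Finset.univ.filter fun i => x i ≠ y i) ⊆ (Finset.univ.erase j).erase l := by
    intro i hi
    simp only [Finset.mem_filter, Finset.mem_univ, true_and] at hi
    simp only [Finset.mem_erase, Finset.mem_univ, and_true]
    exact ⟨fun h => hi (h ▸ hl'), fun h => hi (h ▸ hj)⟩
  have hcard := Finset.card_le_card hsub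
  rw [Finset.card_erase_of_mem (by simpa using hlj), Finset.card_erase_of_mem (Finset.mem_univ _),
    Finset.card_univ, Fintype.card_fin] at hcard
  have hn : 2 ≤ n := by
    have := Finset.card_le_univ ({l, j} : Finset (Fin n))
    rwa [Finset.card_pair hlj, Fintype.card_fin] at this
  change (Finset.univ.filter fun i => x i ≠ y i).card + 2 ≤ n
  omega

/-- Rounding starts near the antipode of `a 0`, but with coordinate `j` kept equal to that of `a 0`,
so that `a 1` costs at most one in distance and can be left out of the rounding. This saves one
index for all later vertices. The only vertex with too large a product with the starting point is
the one excluded in `h2`; at later times it is harmless. -/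
theorem exists_hammingDist_add_ge_of_ne {n : ℕ} (hn : 4 ≤ n) (he : Even n)
    (a : ℕ → Fin n → Bool) {i j : Fin n} (h01 : ∀ l, l ≠ i → l ≠ j → a 1 l = a 0 l)
    (h2 : a 2 ≠ Function.update (fun l => !a 0 l) j (a 0 j)) :
    ∃ z, ∀ m, n + 2 ≤ 2 * (hammingDist z (a m) + m) := by
  have hn' : (4 : ℝ) ≤ n := by exact_mod_cast hn
  have hn0 : (n : ℝ) - 2 ≠ 0 := by linarith
  -- The scale `n - 2` makes the product with `a 0` equal to `-1 / (n - 2)`, just below zero.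
  set x : Fin n → ℝ := fun l => if l = j then boolSign (a 0 j) else -(boolSign (a 0 l) / (n - 2))
    with hx
  have hxsum : ∀ y : Fin n → Bool, ∑ l, x l * boolSign (y l) =
      (boolSign (a 0 j) * boolSign (y j) * (n - 1) - (n - 2 * hammingDist (a 0) y)) / (n - 2) := by
    intro y
    have h1 : ∀ l, x l * boolSign (y l) = (if l = j then
        boolSign (a 0 j) * boolSign (y j) * (n - 1) / (n - 2) else 0)
          - boolSign (a 0 l) * boolSign (y l) / (n - 2) := by
      intro l
      simp only [hx]
      split_ifs with h
      · subst h; field_simp; ring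
      · ring
    simp_rw [h1]
    rw [Finset.sum_sub_distrib, ← Finset.sum_div, sum_boolSign_mul, Fintype.card_fin]
    simp
    ring
  have hx1 : ∀ l, |x l| ≤ 1 := by
    intro l
    simp only [hx]
    split_ifs
    · exact (abs_boolSign _).le
    · rw [abs_neg, abs_div, abs_boolSign, abs_of_pos (by linarith), div_le_one (by linarith)]
      linarith
  obtain ⟨z, hz, hzx, hle, hge, hm⟩ := exists_sign_rounding
    -- The sequence skips `a 1`, so `a m` with `m ≥ 2` has index `m - 1`.
    (fun m l => boolSign (a (if m = 0 then 0 else m + 1) l)) (fun m l => (abs_boolSign _).le) x hx1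
  obtain ⟨w, hw⟩ := exists_boolSign_eq z hz
  have hwj : w j = a 0 j := by
    have h1 := hzx j (by simp [hx, abs_boolSign])
    rw [hw] at h1
    simp only [hx, if_true] at h1
    revert h1
    cases w j <;> cases a 0 j <;> norm_num [boolSign]
  simp only [hw, sum_boolSign_mul, Fintype.card_fin, if_true] at hle hge hm
  have hx0 : ∑ l, x l * boolSign (a 0 l) = -1 / (n - 2) := by
    rw [hxsum, boolSign_mul_self, hammingDist_self]
    congr 1
    push_cast
    ring
  rw [hx0] at hle hge
  obtain ⟨k, rfl⟩ := he
  -- The product with `a 0` is an even integer, negative and above `-3`, hence `-2`.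
  have hd0 : hammingDist w (a 0) = k + 1 := by
    have h1 : (-1 : ℝ) / ((k + k : ℕ) - 2) < 0 := div_neg_of_neg_of_pos (by norm_num) (by linarith)
    have h2 : (-1 : ℝ) ≤ -1 / ((k + k : ℕ) - 2) := by
      rw [le_div_iff₀ (by linarith)]; linarith
    have h3 : (k : ℝ) < hammingDist w (a 0) := by push_cast at *; linarith
    have h4 : (hammingDist w (a 0) : ℝ) < k + 2 := by push_cast at *; linarith
    have h3' : k < hammingDist w (a 0) := by exact_mod_cast h3
    have h4' : hammingDist w (a 0) < k + 2 := by exact_mod_cast h4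
    omega
  refine ⟨w, fun m => ?_⟩
  rcases Nat.lt_or_ge m 2 with h | hm2
  · obtain rfl | rfl : m = 0 ∨ m = 1 := by omega
    · omega
    · have hsub : (Finset.univ.filter fun l => w l ≠ a 0 l) ⊆
          insert i (Finset.univ.filter fun l => w l ≠ a 1 l) := by
        intro l hl
        simp only [Finset.mem_filter, Finset.mem_univ, true_and, Finset.mem_insert] at hl ⊢
        by_cases hli : l = i
        · exact Or.inl hli
        · refine Or.inr ?_
          rwa [h01 l hli (fun h => hl (h ▸ hwj))]
      have hcard : hammingDist w (a 0) ≤ hammingDist w (a 1) + 1 :=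
        (Finset.card_le_card hsub).trans (Finset.card_insert_le _ _)
      omega
  -- At the exceptional vertex the distances from `w` to it and to `a 0` sum to `n - 1`, which is
  -- enough once `m ≥ 3`.
  · by_cases hu : a m = Function.update (fun l => !a 0 l) j (a 0 j)
    · have hm3 : m ≠ 2 := fun h => h2 (h ▸ hu)
      have hsub : (Finset.univ : Finset (Fin (k + k))) ⊆
          insert j ((Finset.univ.filter fun l => w l ≠ a 0 l) ∪
            Finset.univ.filter fun l => w l ≠ a m l) := by
        intro l _
        simp only [Finset.mem_filter, Finset.mem_univ, true_and, Finset.mem_insert,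
          Finset.mem_union]
        by_cases hlj : l = j
        · exact Or.inl hlj
        · rw [hu, Function.update_of_ne hlj]
          refine Or.inr ?_
          cases w l <;> cases a 0 l <;> simp
      have hcard : k + k ≤ hammingDist w (a 0) + hammingDist w (a m) + 1 := by
        have h3 := (Finset.card_le_card hsub).trans (Finset.card_insert_le _ _)
        rw [Finset.card_univ, Fintype.card_fin] at h3
        exact h3.trans (Nat.add_le_add_right (Finset.card_union_le _ _) 1)
      omega
    · have hxm : ∑ l, x l * boolSign (a m l) ≤ 2 := by
        rw [hxsum, div_le_iff₀ (by linarith)]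
        by_cases hj : a 0 j = a m j
        · have h3 := hammingDist_add_two_le hj hu
          have h4 : (hammingDist (a 0) (a m) : ℝ) + 2 ≤ (k + k : ℕ) := by exact_mod_cast h3
          rw [hj, boolSign_mul_self]
          linarith
        · have h3 : hammingDist (a 0) (a m) ≤ k + k := by
            simpa using hammingDist_le_card_fintype (x := a 0) (y := a m)
          have h4 : (hammingDist (a 0) (a m) : ℝ) ≤ (k + k : ℕ) := by exact_mod_cast h3
          have h5 : boolSign (a 0 j) * boolSign (a m j) = -1 := by
            revert hj
            cases a 0 j <;> cases a m j <;> simp [boolSign]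
          rw [h5]
          linarith
      have h3 := hm (m - 1) (by omega)
      rw [if_neg (by omega), Nat.sub_add_cancel (by omega), Nat.cast_sub (by omega)] at h3
      have h4 : ((k + k : ℕ) : ℝ) < 2 * (hammingDist w (a m) + m) := by
        push_cast at *
        linarith
      have h5 : k + k < 2 * (hammingDist w (a m) + m) := by exact_mod_cast h4
      omega

/-- In even dimension, the bound of `exists_hammingDist_add_ge` improves if the first two vertices
of the sequence differ in at most two coordinates. -/
theorem exists_hammingDist_add_ge_of_even {n : ℕ} (hn : 4 ≤ n) (he : Even n)
    (a : ℕ → Fin n → Bool) {i j : Fin n} (hij : i ≠ j)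
    (h01 : ∀ l, l ≠ i → l ≠ j → a 1 l = a 0 l) :
    ∃ z, ∀ m, n + 2 ≤ 2 * (hammingDist z (a m) + m) := by
  -- The exceptional vertices for `i` and for `j` differ, so `a 2` avoids one of them.
  by_cases h : a 2 = Function.update (fun l => !a 0 l) j (a 0 j)
  · refine exists_hammingDist_add_ge_of_ne hn he a (i := j) (j := i)
      (fun l hj hi => h01 l hi hj) fun h' => ?_
    have := congrFun (h.symm.trans h') i
    rw [Function.update_of_ne hij] at this
    simp at this
  · exact exists_hammingDist_add_ge_of_ne hn he a h01 h

/-! ### Spreading balls and Burner's strategy -/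

theorem exists_hammingDist_succ {n : ℕ} {x y : Fin n → Bool} {r : ℕ}
    (h : hammingDist x y = r + 1) : ∃ w, hammingDist w y = r ∧ (hypercubeGraph n).Adj w x := by
  obtain ⟨i, hi⟩ := Function.ne_iff.1 (hammingDist_pos.1 (by omega : 0 < hammingDist x y))
  have h1 : (Finset.univ.filter fun l => Function.update x i (y i) l ≠ y l) =
      (Finset.univ.filter fun l => x l ≠ y l).erase i := by
    ext l
    by_cases hl : l = i
    · subst hl; simp
    · simp [hl]
  have h2 : (Finset.univ.filter fun l => Function.update x i (y i) l ≠ x l) = {i} := by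
    ext l
    by_cases hl : l = i
    · subst hl; simpa using Ne.symm hi
    · simp [hl]
  refine ⟨Function.update x i (y i), ?_, ?_⟩
  · change (Finset.univ.filter fun l => Function.update x i (y i) l ≠ y l).card = r
    rw [h1, Finset.card_erase_of_mem (by simpa using hi)]
    change hammingDist x y - 1 = r
    omega
  · change (Finset.univ.filter fun l => Function.update x i (y i) l ≠ x l).card = 1
    rw [h2, Finset.card_singleton]

theorem hammingDist_add_hammingDist_not {n : ℕ} (z u : Fin n → Bool) :
    hammingDist z u + hammingDist z (fun i => !u i) = n := by
  have h := Finset.card_filter_add_card_filter_not (s := (Finset.univ : Finset (Fin n)))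
    (fun i => z i ≠ u i)
  rw [Finset.card_univ, Fintype.card_fin] at h
  refine Eq.trans ?_ h
  refine congrArg (hammingDist z u + ·) (congrArg Finset.card (Finset.filter_congr fun i _ => ?_))
  change z i ≠ (!u i) ↔ ¬ z i ≠ u i
  cases z i <;> cases u i <;> simp

theorem subset_burnSpread {V : Type*} (G : SimpleGraph V) (B : Set V) : B ⊆ burnSpread G B :=
  fun _ h => Or.inl h

theorem burnSpread_empty {V : Type*} (G : SimpleGraph V) : burnSpread G ∅ = ∅ := by
  ext; simp [burnSpread]

theorem mem_burnSpread_of_hammingDist_le {n : ℕ} {B : Set (Fin n → Bool)} {u : Fin n → Bool}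
    {r : ℕ} (hB : ∀ z, hammingDist z u ≤ r → z ∈ B) (z : Fin n → Bool)
    (hz : hammingDist z u ≤ r + 1) : z ∈ burnSpread (hypercubeGraph n) B := by
  rcases hz.lt_or_eq with h | h
  · exact Or.inl (hB z (by omega))
  · obtain ⟨w, hw, hadj⟩ := exists_hammingDist_succ h
    exact Or.inr ⟨w, hB w hw.le, hadj⟩

theorem exists_hammingDist_le_of_mem_burnSpread {n : ℕ} {B : Set (Fin n → Bool)}
    {u : Fin n → Bool} (hu : u ∈ burnSpread (hypercubeGraph n) B) :
    ∃ v ∈ B, hammingDist u v ≤ 1 := by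
  rcases hu with h | ⟨v, hv, hadj⟩
  · exact ⟨u, h, by simp⟩
  · exact ⟨v, hv, by rw [hammingDist_comm]; exact le_of_eq hadj⟩

/-- If Burner can force the end within `k` steps after every selection, then within `k + 1` steps. -/
theorem burnerForces_succ {V : Type*} {G : SimpleGraph V} {B : Set V} {k : ℕ}
    (h : ∀ v, ∀ p, BurnerForces G p (insert v (burnSpread G B)) k) (p : BurnPlayer) :
    BurnerForces G p B (k + 1) := by
  by_cases hS : burnSpread G B = Set.univ
  · cases p <;> exact Or.inr (Or.inl hS)
  · cases p with
    | burner =>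
      obtain ⟨v, hv⟩ := (Set.ne_univ_iff_exists_notMem _).1 hS
      exact Or.inr (Or.inr ⟨v, hv, h v _⟩)
    | staller => exact Or.inr (Or.inr fun v _ => h v _)

/-- If Burner has burned balls around two antipodal vertices, their growth bounds the rest of the
game. -/
theorem burnerForces_of_antipodal_balls {n : ℕ} (u : Fin n → Bool) (m : ℕ) :
    ∀ (p : BurnPlayer) (B : Set (Fin n → Bool)) (r s : ℕ),
      (∀ z, hammingDist z u ≤ r → z ∈ B) → (∀ z, hammingDist z (fun i => !u i) ≤ s → z ∈ B) →
      n ≤ r + s + 1 + 2 * m → BurnerForces (hypercubeGraph n) p B m := by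
  induction m with
  | zero =>
    intro p B r s hr hs hn
    have hB : B = Set.univ := by
      refine Set.eq_univ_of_forall fun z => ?_
      have h := hammingDist_add_hammingDist_not z u
      rcases le_or_gt (hammingDist z u) r with h1 | h1
      · exact hr z h1
      · exact hs z (by omega)
    cases p <;> simpa [BurnerForces] using hB
  | succ m ih =>
    intro p B r s hr hs hn
    exact burnerForces_succ (fun v p => ih p _ (r + 1) (s + 1)
      (fun z hz => Set.mem_insert_of_mem _ (mem_burnSpread_of_hammingDist_le hr z hz))
      (fun z hz => Set.mem_insert_of_mem _ (mem_burnSpread_of_hammingDist_le hs z hz))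
      (by omega)) p

/-- On his turn Burner burns the antipode of a burned vertex, unless it is burned already. -/
theorem burnerForces_burner_of_ball {n : ℕ} (u : Fin n → Bool) (B : Set (Fin n → Bool)) (r m : ℕ)
    (hr : ∀ z, hammingDist z u ≤ r → z ∈ B) (hn : n ≤ r + 2 + 2 * m) :
    BurnerForces (hypercubeGraph n) .burner B (m + 1) := by
  by_cases hS : burnSpread (hypercubeGraph n) B = Set.univ
  · exact Or.inr (Or.inl hS)
  have key : ∀ v, (fun i => !u i) ∈ insert v (burnSpread (hypercubeGraph n) B) →
      BurnerForces (hypercubeGraph n) .staller (insert v (burnSpread (hypercubeGraph n) B)) m := by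
    intro v hv
    refine burnerForces_of_antipodal_balls u m _ _ (r + 1) 0
      (fun z hz => Set.mem_insert_of_mem _ (mem_burnSpread_of_hammingDist_le hr z hz))
      (fun z hz => ?_) (by omega)
    rw [hammingDist_eq_zero.1 (Nat.le_zero.1 hz)]
    exact hv
  by_cases hu : (fun i => !u i) ∈ burnSpread (hypercubeGraph n) B
  · obtain ⟨v, hv⟩ := (Set.ne_univ_iff_exists_notMem _).1 hS
    exact Or.inr (Or.inr ⟨v, hv, key v (Set.mem_insert_of_mem _ hu)⟩)
  · exact Or.inr (Or.inr ⟨_, hu, key _ (Set.mem_insert _ _)⟩)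

theorem burnerForces_staller_start {n m : ℕ} (hn : n ≤ 2 + 2 * m) :
    BurnerForces (hypercubeGraph n) .staller ∅ (m + 2) := by
  refine Or.inr (Or.inr fun v _ => burnerForces_burner_of_ball v _ 0 m (fun z hz => ?_) (by omega))
  rw [hammingDist_eq_zero.1 (Nat.le_zero.1 hz)]
  exact Set.mem_insert _ _

/-- Staller's move comes before Burner can burn the antipode; by then the first ball has radius one.
-/
theorem burnerForces_burner_start {n m : ℕ} (hn : n ≤ 3 + 2 * m) :
    BurnerForces (hypercubeGraph n) .burner ∅ (m + 3) := by
  refine Or.inr (Or.inr ⟨fun _ => true, by simp [burnSpread_empty], Or.inr (Or.inr fun v _ =>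
    burnerForces_burner_of_ball (fun _ => true) _ 1 m (fun z hz => ?_) (by omega))⟩)
  refine Set.mem_insert_of_mem _ (mem_burnSpread_of_hammingDist_le (r := 0) (fun z hz => ?_) z hz)
  rw [hammingDist_eq_zero.1 (Nat.le_zero.1 hz)]
  exact Set.mem_insert _ _

/-- The unit ball around the first vertex misses at most its antipode, so Staller has no other
vertex to burn. -/
theorem burnerForces_burner_start_two {n : ℕ} (hn : n ≤ 2) :
    BurnerForces (hypercubeGraph n) .burner ∅ 2 := by
  have hball : ∀ z : Fin n → Bool, hammingDist z (fun _ => true) ≤ 0 + 1 →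
      z ∈ burnSpread (hypercubeGraph n)
        (insert (fun _ => true) (burnSpread (hypercubeGraph n) ∅)) := by
    refine mem_burnSpread_of_hammingDist_le fun z hz => ?_
    rw [hammingDist_eq_zero.1 (Nat.le_zero.1 hz)]
    exact Set.mem_insert _ _
  have hanti : ∀ z : Fin n → Bool, z ∉ burnSpread (hypercubeGraph n)
        (insert (fun _ => true) (burnSpread (hypercubeGraph n) ∅)) → z = fun _ => !true := by
    intro z hz
    have h1 : 1 < hammingDist z (fun _ => true) := by
      by_contra h
      exact hz (hball z (by omega))
    have h2 := hammingDist_add_hammingDist_not z fun _ => true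
    exact hammingDist_eq_zero.1 (by omega)
  refine Or.inr (Or.inr ⟨fun _ => true, by simp [burnSpread_empty], Or.inr (Or.inr fun v hv => ?_)⟩)
  refine Set.eq_univ_of_forall fun z => ?_
  by_cases hz : z ∈ burnSpread (hypercubeGraph n)
      (insert (fun _ => true) (burnSpread (hypercubeGraph n) ∅))
  · exact Set.mem_insert_of_mem _ hz
  · rw [hanti z hz, hanti v hv]
    exact Set.mem_insert _ _

/-! ### Covers and lower bounds -/

/-- If Burner can force the end of the game within `k` steps, then the balls around the burned
vertices and the vertices selected in some play cover the cube. -/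
theorem exists_cover_of_burnerForces {n : ℕ} (k : ℕ) :
    ∀ (p : BurnPlayer) (B : Set (Fin n → Bool)), BurnerForces (hypercubeGraph n) p B k →
      ∃ a : ℕ → Fin n → Bool, ∀ z, (∃ u ∈ B, hammingDist z u ≤ k) ∨
        ∃ m, hammingDist z (a m) + m + 1 ≤ k := by
  induction k with
  | zero =>
    intro p B h
    have hB : B = Set.univ := by cases p <;> simpa [BurnerForces] using h
    exact ⟨fun _ _ => true, fun z => Or.inl ⟨z, by simp [hB], by simp⟩⟩
  | succ k ih =>
    intro p B h
    by_cases hS : burnSpread (hypercubeGraph n) B = Set.univ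
    -- The sequence is arbitrary here: the balls around `B` already cover.
    · refine ⟨fun _ _ => true, fun z => Or.inl ?_⟩
      obtain ⟨v, hv, hd⟩ := exists_hammingDist_le_of_mem_burnSpread (B := B) (u := z) (by simp [hS])
      exact ⟨v, hv, by omega⟩
    have hB : B ≠ Set.univ := fun h => hS (Set.univ_subset_iff.1 (h ▸ subset_burnSpread _ _))
    obtain ⟨v, q, hv⟩ : ∃ v q, BurnerForces (hypercubeGraph n) q
        (insert v (burnSpread (hypercubeGraph n) B)) k := by
      cases p with
      | burner =>
        rcases h with h | h | ⟨v, -, h⟩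
        · exact absurd h hB
        · exact absurd h hS
        · exact ⟨v, _, h⟩
      | staller =>
        rcases h with h | h | h
        · exact absurd h hB
        · exact absurd h hS
        · obtain ⟨v, hv⟩ := (Set.ne_univ_iff_exists_notMem _).1 hS
          exact ⟨v, _, h v hv⟩
    obtain ⟨a, ha⟩ := ih q _ hv
    -- Prepending `v` delays every later selection by one step.
    refine ⟨fun m => m.casesOn v a, fun z => ?_⟩
    rcases ha z with ⟨u, hu, hd⟩ | ⟨m, hm⟩
    · rcases hu with rfl | hu
      · exact Or.inr ⟨0, by simpa using hd⟩
      · obtain ⟨w, hw, hd'⟩ := exists_hammingDist_le_of_mem_burnSpread hu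
        exact Or.inl ⟨w, hw, (hammingDist_triangle z u w).trans (by omega)⟩
    · exact Or.inr ⟨m + 1, by change hammingDist z (a m) + (m + 1) + 1 ≤ k + 1; omega⟩

theorem le_of_burnerForces {n k : ℕ} {p : BurnPlayer}
    (h : BurnerForces (hypercubeGraph n) p ∅ k) : n + 2 ≤ 2 * k := by
  obtain ⟨a, ha⟩ := exists_cover_of_burnerForces k p ∅ h
  obtain ⟨z, hz⟩ := exists_hammingDist_add_ge a
  rcases ha z with ⟨u, hu, -⟩ | ⟨m, hm⟩
  · exact hu.elim
  · have := hz m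
    omega

theorem le_of_burnerForces_burner {n k : ℕ} (hn : 4 ≤ n) (he : Even n)
    (h : BurnerForces (hypercubeGraph n) .burner ∅ k) : n + 4 ≤ 2 * k := by
  have hk := le_of_burnerForces h
  obtain ⟨k, rfl⟩ : ∃ l, k = l + 2 := ⟨k - 2, by omega⟩
  have hempty : (∅ : Set (Fin n → Bool)) ≠ Set.univ := Set.empty_ne_univ
  rcases h with h | h | ⟨v, -, h⟩
  · exact absurd h hempty
  · rw [burnSpread_empty] at h
    exact absurd h hempty
  rw [burnSpread_empty, insert_empty_eq] at h
  set i : Fin n := ⟨0, by omega⟩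
  set j : Fin n := ⟨1, by omega⟩
  have hij : i ≠ j := by simp [i, j, Fin.ext_iff]
  -- Staller's reply is at distance two, just outside the fire around `v`.
  set u : Fin n → Bool := Function.update (Function.update v i (!v i)) j (!v j) with hu
  have huj : u j ≠ v j := by simp [hu]
  have hui : u i ≠ v i := by simp [hu, Function.update_of_ne hij]
  have hdist : 2 ≤ hammingDist u v := by
    rw [← Finset.card_pair hij]
    refine Finset.card_le_card fun l hl => ?_
    rw [Finset.mem_insert, Finset.mem_singleton] at hl
    rcases hl with rfl | rfl <;> simpa using ‹_›
  have hus : u ∉ burnSpread (hypercubeGraph n) {v} := by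
    intro hmem
    obtain ⟨w, rfl, hd⟩ := exists_hammingDist_le_of_mem_burnSpread hmem
    omega
  have hforce : BurnerForces (hypercubeGraph n) .burner
      (insert u (burnSpread (hypercubeGraph n) {v})) k := by
    rcases h with h | h | h
    · exact absurd (subset_burnSpread _ _ (h ▸ Set.mem_univ u)) hus
    · exact absurd (h ▸ Set.mem_univ u) hus
    · exact h u hus
  obtain ⟨a, ha⟩ := exists_cover_of_burnerForces k _ _ hforce
  -- The full play is `v`, `u`, then `a`, so `a m` has index `m + 2`.
  obtain ⟨z, hz⟩ := exists_hammingDist_add_ge_of_even hn he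
    (fun m => m.casesOn v fun m => m.casesOn u a) hij
    (fun l hi hj => by simp [hu, Function.update_of_ne hi, Function.update_of_ne hj])
  rcases ha z with ⟨w, hw, hd⟩ | ⟨m, hm⟩
  · rcases hw with hw | hw
    · have : n + 2 ≤ 2 * (hammingDist z u + 1) := hz 1
      rw [hw] at hd
      omega
    · obtain ⟨w', rfl, hd'⟩ := exists_hammingDist_le_of_mem_burnSpread hw
      have h1 : n + 2 ≤ 2 * (hammingDist z w' + 0) := hz 0
      have h2 := hammingDist_triangle z w w'
      omega
  · have : n + 2 ≤ 2 * (hammingDist z (a m) + (m + 2)) := hz (m + 2)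
    omega

/-! ### The values of the game -/

theorem burningGameLength_eq {V : Type*} [Finite V] {G : SimpleGraph V} {p : BurnPlayer} {K : ℕ}
    (hK : BurnerForces G p ∅ K) (hle : ∀ k, BurnerForces G p ∅ k → K ≤ k) :
    burningGameLength G p = K :=
  le_antisymm (Nat.sInf_le hK) (le_csInf ⟨K, hK⟩ hle)

theorem natCeil_half (m : ℕ) : ⌈(m : ℚ) / 2⌉₊ = (m + 1) / 2 := by
  rcases Nat.even_or_odd' m with ⟨k, rfl | rfl⟩
  · rw [show ((2 * k : ℕ) : ℚ) / 2 = (k : ℕ) by push_cast; ring, Nat.ceil_natCast]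
    omega
  · rw [show (2 * k + 1 + 1) / 2 = k + 1 by omega, Nat.ceil_eq_iff (by omega)]
    push_cast
    constructor <;> linarith

theorem mainTheorem3 (n : ℕ) (hn : 1 ≤ n) :
    gameBurningNumber (hypercubeGraph n) =
        (if n = 1 ∨ n = 2 then 2 else ⌈((n : ℚ) + 1) / 2⌉₊ + 1) ∧
      stallerStartGameBurningNumber (hypercubeGraph n) = ⌈(n : ℚ) / 2⌉₊ + 1 := by
  have hceil : ⌈((n : ℚ) + 1) / 2⌉₊ = (n + 2) / 2 := by
    have := natCeil_half (n + 1)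
    push_cast at this
    exact this
  rw [hceil, natCeil_half]
  constructor
  · split_ifs with h
    · refine burningGameLength_eq (burnerForces_burner_start_two (by omega)) fun k hk => ?_
      have := le_of_burnerForces hk
      omega
    · obtain ⟨m, hm⟩ : ∃ m, (n + 2) / 2 + 1 = m + 3 := ⟨(n + 2) / 2 - 2, by omega⟩
      rw [hm]
      refine burningGameLength_eq (burnerForces_burner_start (by omega)) fun k hk => ?_
      rcases Nat.even_or_odd' n with ⟨l, hl | hl⟩
      · have := le_of_burnerForces_burner (by omega) ⟨l, by omega⟩ hk
        omega
      · have := le_of_burnerForces hk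
        omega
  · obtain ⟨m, hm⟩ : ∃ m, (n + 1) / 2 + 1 = m + 2 := ⟨(n + 1) / 2 - 1, by omega⟩
    rw [hm]
    refine burningGameLength_eq (burnerForces_staller_start (by omega)) fun k hk => ?_
    have := le_of_burnerForces hk
    omega
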